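/- Let $\mathcal{A}$ be a Grothendieck category (an abelian category with coproducts, exact filtered colimits and a generator), let $U$ be a generator of $\mathcal{A}$, let $R=\operatorname{End}_{\mathcal{A}}(U)$, and let $S=\operatorname{Hom}_{\mathcal{A}}(U,-):\mathcal{A}\to\operatorname{Mod}(R)$ be the functor to the category of right $R$-modules, where $R$ acts on $\operatorname{Hom}_{\mathcal{A}}(U,X)$ by composition on the right. For objects $M,N$ of an abelian category, $N$ is called *strongly $M$-Rickart* if for every morphism $f:M\to N$ the kernel $k:K\to M$ of $f$ is a fully invariant section, that is: there is $k':M\to K$ with $k'k=1_K$, and for every $h:M\to M$ there is $\alpha:K\to K$ with $hk=k\alpha$. Then for all objects $M,N$ of $\mathcal{A}$: $N$ is a strongly $M$-Rickart object of $\mathcal{A}$ if and only if $S(N)$ is a strongly $S(M)$-Rickart right $R$-module (that is, a strongly $S(M)$-Rickart object of the abelian category $\operatorname{Mod}(R)$). -/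

import Mathlib

open CategoryTheory CategoryTheory.Limits

universe v u

/-- A monomorphism `k : K ⟶ M` is *fully invariant* if, for every endomorphism `h` of `M`,
the composite "`h` after `k`" factors through `k`. -/
def IsFullyInvariant {A : Type u} [Category.{v} A] {K M : A} (k : K ⟶ M) [Mono k] : Prop :=
  ∀ h : M ⟶ M, ∃ α : K ⟶ K, k ≫ h = α ≫ k

/-- `IsStronglyRickart M N`: the object `N` is *strongly `M`-Rickart*, i.e. the kernel of every
morphism `f : M ⟶ N` is a fully invariant section (split monomorphism). -/
def IsStronglyRickart {A : Type u} [Category.{v} A] [Abelian A] (M N : A) : Prop :=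
  ∀ f : M ⟶ N, IsSplitMono (kernel.ι f) ∧ IsFullyInvariant (kernel.ι f)

/-! By Gabriel–Popescu, `Hom(U, -)` is fully faithful; it also preserves kernels. Hence retractions
and the maps `α` witnessing full invariance transfer both ways between `ker f` and the kernel of the
image of `f`. -/

/-- Being a fully invariant split monomorphism is preserved and reflected by fully faithful
functors, up to isomorphism of subobjects. -/
theorem isSplitMono_and_isFullyInvariant_iff_map {A : Type*} [Category A] {B : Type*} [Category B]
    (F : A ⥤ B) [F.Full] [F.Faithful] {K M : A} (k : K ⟶ M) [Mono k]
    {L : B} (l : L ⟶ F.obj M) [Mono l] (e : F.obj K ≅ L) (he : e.hom ≫ l = F.map k) :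
    (IsSplitMono k ∧ IsFullyInvariant k) ↔ (IsSplitMono l ∧ IsFullyInvariant l) := by
  have he' : l = e.inv ≫ F.map k := by rw [← he, Iso.inv_hom_id_assoc]
  constructor
  · rintro ⟨⟨⟨s⟩⟩, hinv⟩
    refine ⟨⟨⟨⟨F.map s.retraction ≫ e.hom, ?_⟩⟩⟩, fun h ↦ ?_⟩
    · rw [he', Category.assoc, ← F.map_comp_assoc, s.id, F.map_id, Category.id_comp,
        Iso.inv_hom_id]
    · obtain ⟨α, hα⟩ := hinv (F.preimage h)
      refine ⟨e.inv ≫ F.map α ≫ e.hom, ?_⟩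
      rw [Category.assoc, Category.assoc, he, ← F.map_comp, ← hα, F.map_comp, F.map_preimage,
        he', Category.assoc]
  · rintro ⟨⟨⟨s⟩⟩, hinv⟩
    refine ⟨⟨⟨⟨F.preimage (s.retraction ≫ e.inv), ?_⟩⟩⟩, fun h ↦ ?_⟩
    · apply F.map_injective
      rw [F.map_comp, F.map_preimage, ← he, Category.assoc, reassoc_of% s.id, Iso.hom_inv_id,
        F.map_id]
    · obtain ⟨α, hα⟩ := hinv (F.map h)
      refine ⟨F.preimage (e.hom ≫ α ≫ e.inv), F.map_injective ?_⟩
      rw [F.map_comp, F.map_comp, F.map_preimage, ← he, Category.assoc, hα]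
      simp

/-- A fully faithful functor between abelian categories that preserves kernels preserves and
reflects the strong relative Rickart property. -/
theorem isStronglyRickart_iff_map {A : Type*} [Category A] [Abelian A] {B : Type*} [Category B]
    [Abelian B] (F : A ⥤ B) [F.Full] [F.Faithful] [F.PreservesZeroMorphisms]
    [∀ {X Y : A} (f : X ⟶ Y), PreservesLimit (parallelPair f 0) F] (M N : A) :
    IsStronglyRickart M N ↔ IsStronglyRickart (F.obj M) (F.obj N) := by
  have key (f : M ⟶ N) := isSplitMono_and_isFullyInvariant_iff_map F (kernel.ι f)
    (kernel.ι (F.map f)) (PreservesKernel.iso F f) (by simp)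
  refine ⟨fun H g ↦ ?_, fun H f ↦ (key f).2 (H _)⟩
  -- Fullness: no morphism between the images is new, so testing those of the form `F.map f`
  -- suffices.
  obtain ⟨f, rfl⟩ := F.map_surjective g
  exact (key f).1 (H f)

/-- The ring `R = End U` has multiplication "composition of maps" (`r * s` is `s` followed by `r`),
and a right `R`-module is a module over the opposite ring `Rᵐᵒᵖ`. The functor
`preadditiveCoyonedaObj U : A ⥤ ModuleCat (End U)ᵐᵒᵖ` is `Hom(U, -)`, with `R` acting on the right
of `Hom(U, X)` by precomposition. -/
theorem corollary4p2 {A : Type u} [Category.{v} A] [Abelian A] [IsGrothendieckAbelian.{v} A]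
    (U : A) (hU : IsSeparator U) (M N : A) :
    IsStronglyRickart M N ↔
      IsStronglyRickart ((preadditiveCoyonedaObj U).obj M : ModuleCat.{v} (End U)ᵐᵒᵖ)
        ((preadditiveCoyonedaObj U).obj N) := by
  have := IsGrothendieckAbelian.GabrielPopescu.full U hU
  have : (preadditiveCoyonedaObj U).Faithful :=
    (isSeparator_iff_faithful_preadditiveCoyonedaObj U).1 hU
  exact isStronglyRickart_iff_map (preadditiveCoyonedaObj U) M N
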